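/- Let $G=(V,E)$ be a finite undirected graph without loops; parallel edges are allowed. An orientation of $G$ is obtained by directing each edge of $G$ from one of its end-nodes to the other; it is strong if it has a directed path (dipath) from every node to every node. Let $\varrho_D(v)$ denote the number of arcs of an orientation $D$ with head $v$, and call $(\varrho_D(v))_{v\in V}$ the in-degree vector of $D$. A strong orientation $D$ of $G$ is decreasingly minimal (dec-min) if, for every strong orientation $D'$ of $G$, the in-degree vector of $D$ rearranged in decreasing order is lexicographically smaller than or equal to the in-degree vector of $D'$ rearranged in decreasing order. It is increasingly maximal (inc-max) if, for every strong orientation $D'$ of $G$, the in-degree vector of $D$ rearranged in increasing order is lexicographically larger than or equal to the in-degree vector of $D'$ rearranged in increasing order. Let $D$ be a strong orientation of $G$, with $\varrho=\varrho_D$. Then $D$ is dec-min if and only if there are no nodes $s,t\in V$ with $\varrho(t)\ge\varrho(s)+2$ for which $D$ has two arc-disjoint dipaths from $s$ to $t$. Moreover, $D$ is dec-min if and only if it is inc-max. -/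

import Mathlib

open scoped Graph

/-! ### Lexicographic comparison of vectors after sorting -/

section Vectors

variable {V : Type*} [Fintype V]

/-- `x↓`: the components of `x` rearranged in decreasing order. -/
noncomputable def sortDecreasing (x : V → ℕ) : List ℕ :=
  (Finset.univ.val.map x).sort (· ≥ ·)

/-- `x↑`: the components of `x` rearranged in increasing order. -/
noncomputable def sortIncreasing (x : V → ℕ) : List ℕ :=
  (Finset.univ.val.map x).sort (· ≤ ·)

/-- `x` and `y` are value-equivalent: `x↓ = y↓`. -/
def ValueEquivalent (x y : V → ℕ) : Prop :=
  sortDecreasing x = sortDecreasing y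

/-- `x <_dec y`: at the first position where `x↓` and `y↓` differ, `x↓` is smaller.
(Both lists have length `Fintype.card V`.) -/
def DecLT (x y : V → ℕ) : Prop :=
  List.Lex (· < ·) (sortDecreasing x) (sortDecreasing y)

/-- `x ≤_dec y`: `x` is decreasingly smaller than `y` or value-equivalent to it. -/
def DecLE (x y : V → ℕ) : Prop :=
  DecLT x y ∨ ValueEquivalent x y

/-- `y >_inc x`: at the first position where `y↑` and `x↑` differ, `y↑` is larger. -/
def IncGT (y x : V → ℕ) : Prop :=
  List.Lex (· > ·) (sortIncreasing y) (sortIncreasing x)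

/-- `y ≥_inc x`: `y` is increasingly larger than `x` or value-equivalent to it. -/
def IncGE (y x : V → ℕ) : Prop :=
  IncGT y x ∨ ValueEquivalent y x

/-- `m` is a decreasingly minimal element of the set `Q` of vectors. -/
def IsDecMin (Q : Set (V → ℕ)) (m : V → ℕ) : Prop :=
  m ∈ Q ∧ ∀ y ∈ Q, DecLE m y

/-- `m` is an increasingly maximal element of the set `Q` of vectors. -/
def IsIncMax (Q : Set (V → ℕ)) (m : V → ℕ) : Prop :=
  m ∈ Q ∧ ∀ y ∈ Q, IncGE m y

end Vectors

/-! ### Directed multigraphs -/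

/-- A directed multigraph with node set `V` and arc set `A`. -/
structure DirMultigraph (V A : Type*) where
  tail : A → V
  head : A → V

namespace DirMultigraph

variable {V A : Type*} (D : DirMultigraph V A)

/-- The in-degree of `v`: the number of arcs with head `v`. -/
noncomputable def inDegree (v : V) : ℕ :=
  {a : A | D.head a = v}.ncard

/-- `D.IsDiwalk s t p`: the list of arcs `p` is a directed walk from `s` to `t`. -/
inductive IsDiwalk : V → V → List A → Prop
  | nil (v : V) : IsDiwalk v v []
  | cons (a : A) {t : V} {p : List A} (h : IsDiwalk (D.head a) t p) :
      IsDiwalk (D.tail a) t (a :: p)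

/-- `D.IsDipath s t p`: the list of arcs `p` is a dipath from `s` to `t`, that is,
a directed walk whose nodes (`s` followed by the heads of the arcs) are distinct. -/
def IsDipath (s t : V) (p : List A) : Prop :=
  D.IsDiwalk s t p ∧ (s :: p.map D.head).Nodup

/-- `D` is strongly connected: every node can be reached from every node by a dipath. -/
def IsStrong : Prop :=
  ∀ u v : V, ∃ p : List A, D.IsDipath u v p

/-- There are two arc-disjoint dipaths from `s` to `t`. For `s ≠ t`, the only case in use,
dipaths have at least one arc, so disjoint ones are different. -/
def HasTwoArcDisjointDipaths (s t : V) : Prop :=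
  ∃ p q : List A, D.IsDipath s t p ∧ D.IsDipath s t q ∧ p.Disjoint q

end DirMultigraph

/-! ### Orientations of an undirected multigraph -/

namespace Graph

variable {α β : Type*}

/-- An orientation of `G`: a directed multigraph on the nodes of `G` whose arcs are the edges
of `G`, each directed from one of its two end-nodes to the other. -/
structure Orientation (G : Graph α β) extends DirMultigraph V(G) E(G) where
  isLink : ∀ e : E(G), G.IsLink e (tail e) (head e)

/-- The set of in-degree vectors of the strong orientations of `G`. -/
def strongInDegrees (G : Graph α β) : Set (V(G) → ℕ) :=
  {x | ∃ D : G.Orientation, D.IsStrong ∧ x = D.inDegree}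

/-- `D` is a dec-min strong orientation: it is strong and its in-degree vector is
decreasingly minimal over the strong orientations of `G`. -/
def Orientation.IsDecMinStrong {G : Graph α β} [Fintype V(G)] (D : G.Orientation) : Prop :=
  D.IsStrong ∧ IsDecMin G.strongInDegrees D.inDegree

/-- `D` is an inc-max strong orientation: it is strong and its in-degree vector is
increasingly maximal over the strong orientations of `G`. -/
def Orientation.IsIncMaxStrong {G : Graph α β} [Fintype V(G)] (D : G.Orientation) : Prop :=
  D.IsStrong ∧ IsIncMax G.strongInDegrees D.inDegree

end Graph

/-! ### Sorted vectors and truncated sums -/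

/-! Both orders are controlled by the truncated sums `∑ v, (x v - k)`: a strict decrease in either
order makes some truncated sum (for `IncGT`, some `∑ v, (k - x v)`) strictly smaller. Since the
total in-degree is fixed, a vector minimizing all truncated sums at once is both dec-min and
inc-max. If two arc-disjoint dipaths lead from `s` to `t` and `t` exceeds `s` by at least 2,
reversing one of them keeps `D` strong, lowers no set's connectivity below 1, and improves the
truncated sums (`exists_transfer`). Otherwise, fix `k` and let `H` be the nodes linked to some node
of in-degree above `k`. In-degrees are at least `k` on `H` and at most `k` off it, so the truncated
sum is `∑ v ∈ H, (D.inDegree v - k)`. It remains to see that `H` has minimum total in-degree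
(`sum_inDegree_le_of_closed`). Sets entered by one arc have this property, and uncrossing carries it
over to `H`. -/

theorem List.exists_sum_sub_lt_of_lex {l₁ l₂ : List ℕ} (h : List.Lex (· < ·) l₁ l₂)
    (hs : l₁.Pairwise (· ≥ ·)) (hl : l₁.length = l₂.length) :
    ∃ k, (l₁.map (· - k)).sum < (l₂.map (· - k)).sum := by
  induction h with
  | nil => simp at hl
  | @cons a l₁ l₂ h ih =>
    obtain ⟨k, hk⟩ := ih (List.pairwise_cons.1 hs).2 (by simpa using hl)
    exact ⟨k, by simpa using hk⟩
  | @rel a l₁ b l₂ hab =>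
    -- Truncating at the first differing entry kills all of the smaller list, which is decreasing,
    -- but not `b > a`.
    refine ⟨a, ?_⟩
    have h0 : ((a :: l₁).map (· - a)).sum = 0 := by
      rw [List.sum_eq_zero_iff]
      intro x hx
      obtain ⟨y, hy, rfl⟩ := List.mem_map.1 hx
      rcases List.mem_cons.1 hy with rfl | hy
      · simp
      · have := (List.pairwise_cons.1 hs).1 y hy
        omega
    rw [h0, List.map_cons, List.sum_cons]
    omega

theorem List.exists_sum_sub_lt_of_lex_gt {l₁ l₂ : List ℕ} (h : List.Lex (· > ·) l₁ l₂)
    (hs : l₁.Pairwise (· ≤ ·)) (hl : l₁.length = l₂.length) :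
    ∃ k, (l₁.map (k - ·)).sum < (l₂.map (k - ·)).sum := by
  induction h with
  | nil => simp at hl
  | @cons a l₁ l₂ h ih =>
    obtain ⟨k, hk⟩ := ih (List.pairwise_cons.1 hs).2 (by simpa using hl)
    exact ⟨k, by simpa using hk⟩
  | @rel a l₁ b l₂ hab =>
    refine ⟨a, ?_⟩
    have h0 : ((a :: l₁).map (a - ·)).sum = 0 := by
      rw [List.sum_eq_zero_iff]
      intro x hx
      obtain ⟨y, hy, rfl⟩ := List.mem_map.1 hx
      rcases List.mem_cons.1 hy with rfl | hy
      · simp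
      · have := (List.pairwise_cons.1 hs).1 y hy
        omega
    rw [h0, List.map_cons, List.sum_cons]
    omega

section Vectors

variable {V : Type*} [Fintype V]

theorem sum_map_sortDecreasing (x : V → ℕ) (f : ℕ → ℕ) :
    ((sortDecreasing x).map f).sum = ∑ v, f (x v) := by
  rw [← Multiset.sum_coe, ← Multiset.map_coe, sortDecreasing, Multiset.sort_eq, Multiset.map_map]
  rfl

theorem sum_map_sortIncreasing (x : V → ℕ) (f : ℕ → ℕ) :
    ((sortIncreasing x).map f).sum = ∑ v, f (x v) := by
  rw [← Multiset.sum_coe, ← Multiset.map_coe, sortIncreasing, Multiset.sort_eq, Multiset.map_map]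
  rfl

theorem length_sortDecreasing (x : V → ℕ) : (sortDecreasing x).length = Fintype.card V := by
  simp [sortDecreasing]

theorem length_sortIncreasing (x : V → ℕ) : (sortIncreasing x).length = Fintype.card V := by
  simp [sortIncreasing]

theorem DecLT.exists_sum_sub_lt {x y : V → ℕ} (h : DecLT x y) :
    ∃ k, ∑ v, (x v - k) < ∑ v, (y v - k) := by
  obtain ⟨k, hk⟩ := List.exists_sum_sub_lt_of_lex h (Multiset.pairwise_sort _ _)
    (by rw [length_sortDecreasing, length_sortDecreasing])
  exact ⟨k, by rwa [sum_map_sortDecreasing x (· - k), sum_map_sortDecreasing y (· - k)] at hk⟩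

theorem IncGT.exists_sum_sub_lt {x y : V → ℕ} (h : IncGT x y) :
    ∃ k, ∑ v, (k - x v) < ∑ v, (k - y v) := by
  obtain ⟨k, hk⟩ := List.exists_sum_sub_lt_of_lex_gt h (Multiset.pairwise_sort _ _)
    (by rw [length_sortIncreasing, length_sortIncreasing])
  exact ⟨k, by rwa [sum_map_sortIncreasing x (k - ·), sum_map_sortIncreasing y (k - ·)] at hk⟩

theorem ValueEquivalent.sum_eq {x y : V → ℕ} (h : ValueEquivalent x y) (f : ℕ → ℕ) :
    ∑ v, f (x v) = ∑ v, f (y v) := by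
  rw [← sum_map_sortDecreasing, ← sum_map_sortDecreasing, show sortDecreasing x = _ from h]

theorem valueEquivalent_of_sortIncreasing_eq {x y : V → ℕ}
    (h : sortIncreasing x = sortIncreasing y) : ValueEquivalent x y := by
  have h' : Finset.univ.val.map x = Finset.univ.val.map y := by
    rw [← Multiset.sort_eq (Finset.univ.val.map x) (· ≤ ·),
      ← Multiset.sort_eq (Finset.univ.val.map y) (· ≤ ·)]
    exact congrArg _ h
  rw [ValueEquivalent, sortDecreasing, sortDecreasing, h']

theorem decLE_or_decLT (x y : V → ℕ) : DecLE x y ∨ DecLT y x := by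
  rcases trichotomous_of (List.Lex (· < ·)) (sortDecreasing x) (sortDecreasing y) with h | h | h
  · exact .inl (.inl h)
  · exact .inl (.inr h)
  · exact .inr h

theorem incGE_or_incGT (x y : V → ℕ) : IncGE x y ∨ IncGT y x := by
  rcases trichotomous_of (List.Lex (· > ·)) (sortIncreasing x) (sortIncreasing y) with h | h | h
  · exact .inl (.inl h)
  · exact .inl (.inr (valueEquivalent_of_sortIncreasing_eq h))
  · exact .inr h

/-- For vectors of equal total, lower and upper truncated sums differ by the same constant, so both
orders test the same quantities. -/
theorem sum_sub_add_sum (x : V → ℕ) (k : ℕ) :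
    ∑ v, (k - x v) + ∑ v, x v = ∑ v, (x v - k) + Fintype.card V * k := by
  have : Fintype.card V * k = ∑ _v : V, k := by simp
  rw [this, ← Finset.sum_add_distrib, ← Finset.sum_add_distrib]
  exact Finset.sum_congr rfl fun v _ => by omega

theorem decLE_of_sum_sub_le {x y : V → ℕ} (h : ∀ k, ∑ v, (x v - k) ≤ ∑ v, (y v - k)) :
    DecLE x y := by
  refine (decLE_or_decLT x y).resolve_right fun hlt => ?_
  obtain ⟨k, hk⟩ := hlt.exists_sum_sub_lt
  exact absurd (h k) hk.not_ge

theorem incGE_of_sum_sub_le {x y : V → ℕ} (hsum : ∑ v, x v = ∑ v, y v)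
    (h : ∀ k, ∑ v, (x v - k) ≤ ∑ v, (y v - k)) : IncGE x y := by
  refine (incGE_or_incGT x y).resolve_right fun hlt => ?_
  obtain ⟨k, hk⟩ := hlt.exists_sum_sub_lt
  have := h k
  have := sum_sub_add_sum x k
  have := sum_sub_add_sum y k
  omega

theorem DecLE.exists_sum_sub_lt_or_forall_eq {x y : V → ℕ} (h : DecLE x y) :
    (∃ k, ∑ v, (x v - k) < ∑ v, (y v - k)) ∨ ∀ k, ∑ v, (x v - k) = ∑ v, (y v - k) :=
  h.imp DecLT.exists_sum_sub_lt fun h k => h.sum_eq (· - k)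

theorem IncGE.exists_sum_sub_lt_or_forall_eq {x y : V → ℕ} (h : IncGE x y)
    (hsum : ∑ v, x v = ∑ v, y v) :
    (∃ k, ∑ v, (x v - k) < ∑ v, (y v - k)) ∨ ∀ k, ∑ v, (x v - k) = ∑ v, (y v - k) := by
  refine h.imp (fun h => ?_) fun h k => h.sum_eq (· - k)
  obtain ⟨k, hk⟩ := h.exists_sum_sub_lt
  have := sum_sub_add_sum x k
  have := sum_sub_add_sum y k
  exact ⟨k, by omega⟩

/-- Moving a unit from `t` to `s`, where `x t ≥ x s + 2`, decreases all truncated sums weakly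
and one of them strictly. -/
theorem sum_sub_lt_of_transfer [DecidableEq V] {x y : V → ℕ} {s t : V} (hst : x s + 2 ≤ x t)
    (hy : ∀ v, (y v : ℤ) = x v + (if v = s then 1 else 0) - (if v = t then 1 else 0)) :
    (∀ k, ∑ v, (y v - k) ≤ ∑ v, (x v - k)) ∧ ∃ k, ∑ v, (y v - k) < ∑ v, (x v - k) := by
  have hne : s ≠ t := by rintro rfl; omega
  have hs : y s = x s + 1 := by have := hy s; simp [hne] at this; omega
  have ht : y t = x t - 1 := by have := hy t; simp [hne.symm] at this; omega
  have split (f : V → ℕ) : ∑ v, f v = f s + (f t + ∑ v ∈ (Finset.univ.erase s).erase t, f v) := by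
    rw [Finset.add_sum_erase _ _ (by simp [hne.symm]), Finset.add_sum_erase _ _ (by simp)]
  have rest (k : ℕ) : ∑ v ∈ (Finset.univ.erase s).erase t, (y v - k) =
      ∑ v ∈ (Finset.univ.erase s).erase t, (x v - k) := by
    refine Finset.sum_congr rfl fun v hv => ?_
    simp only [Finset.mem_erase, Finset.mem_univ, and_true] at hv
    have := hy v
    simp [hv.1, hv.2] at this
    omega
  -- At threshold `x t - 1` the term of `t` drops from 1 to 0, while that of `s` stays 0 because `x
  -- s + 1 ≤ x t - 1`.
  refine ⟨fun k => ?_, x t - 1, ?_⟩ <;>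
  · rw [split, split (fun v => x v - _), rest, hs, ht]
    omega

end Vectors

/-- If the members of a union-closed (for intersecting pairs) family that lie in `U` cover `U`,
then a weight that is nonnegative on all members is nonnegative on `U`. -/
theorem Finset.sum_nonneg_of_intersecting_cover {V : Type*} [DecidableEq V]
    (P : Finset V → Prop) (hP : ∀ X Y, P X → P Y → (X ∩ Y).Nonempty → P (X ∪ Y))
    (f : V → ℤ) (hf : ∀ X, P X → 0 ≤ ∑ v ∈ X, f v) (U : Finset V)
    (hU : ∀ u ∈ U, ∃ X, P X ∧ u ∈ X ∧ X ⊆ U) : 0 ≤ ∑ v ∈ U, f v := by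
  induction U using Finset.strongInduction with
  | H U ih =>
    classical
    rcases U.eq_empty_or_nonempty with rfl | ⟨u, hu⟩
    · simp
    obtain ⟨X₀, hX₀, huX₀, hX₀U⟩ := hU u hu
    -- A member inside `U` that meets a largest one `M` lies in `M`, so the members covering points
    -- of `U \ M` avoid `M` and induction applies.
    obtain ⟨M, hM, hmax⟩ := (U.powerset.filter fun X => P X ∧ X.Nonempty).exists_max_image
      Finset.card ⟨X₀, by simp [hX₀, hX₀U]; exact ⟨u, huX₀⟩⟩
    simp only [Finset.mem_filter, Finset.mem_powerset] at hM hmax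
    rw [← Finset.sum_sdiff hM.1]
    refine add_nonneg (ih _ ?_ fun w hw => ?_) (hf M hM.2.1)
    · exact Finset.sdiff_ssubset hM.1 hM.2.2
    · rw [Finset.mem_sdiff] at hw
      obtain ⟨X, hX, hwX, hXU⟩ := hU w hw.1
      refine ⟨X, hX, hwX, fun z hz => Finset.mem_sdiff.2 ⟨hXU hz, fun hzM => ?_⟩⟩
      have h := hmax (X ∪ M) ⟨Finset.union_subset hXU hM.1,
        hP X M hX hM.2.1 ⟨z, by simp [hz, hzM]⟩, ⟨z, by simp [hz]⟩⟩
      have : M ⊂ X ∪ M := Finset.ssubset_iff.2 ⟨w, hw.2, by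
        intro a; simp only [Finset.mem_insert, Finset.mem_union]; rintro (rfl | h) <;> tauto⟩
      exact absurd (Finset.card_lt_card this) h.not_gt

/-! ### Cuts, reversals and flows in directed multigraphs -/

namespace DirMultigraph

variable {V A : Type*} {D D' : DirMultigraph V A}

theorem IsDiwalk.exists_mem_entering {s t : V} {p : List A} (h : D.IsDiwalk s t p)
    (X : Finset V) (hs : s ∉ X) (ht : t ∈ X) : ∃ a ∈ p, D.head a ∈ X ∧ D.tail a ∉ X := by
  induction h with
  | nil => exact absurd ht hs
  | cons a h ih =>
    by_cases ha : D.head a ∈ X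
    · exact ⟨a, by simp, ha, hs⟩
    · obtain ⟨b, hb, h'⟩ := ih ha ht
      exact ⟨b, by simp [hb], h'⟩

theorem IsDiwalk.sum_eq {s t : V} {p : List A} (h : D.IsDiwalk s t p) (g : V → ℤ) :
    (p.map fun a => g (D.tail a) - g (D.head a)).sum = g s - g t := by
  induction h with
  | nil => simp
  | cons a h ih => simp [ih]

theorem IsDipath.nodup {s t : V} {p : List A} (h : D.IsDipath s t p) : p.Nodup :=
  (List.nodup_cons.1 h.2).2.of_map

theorem IsDipath.sum_eq [DecidableEq A] {s t : V} {p : List A} (h : D.IsDipath s t p)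
    (g : V → ℤ) : ∑ a ∈ p.toFinset, (g (D.tail a) - g (D.head a)) = g s - g t := by
  rw [List.sum_toFinset _ h.nodup, h.1.sum_eq]

theorem IsDipath.exists_suffix {s t v : V} {p : List A} (h : D.IsDipath s t p)
    (hv : v ∈ s :: p.map D.head) : ∃ q, D.IsDipath v t q ∧ q ⊆ p := by
  obtain ⟨hw, hn⟩ := h
  induction hw with
  | nil u =>
    obtain rfl : v = u := by simpa using hv
    exact ⟨[], ⟨.nil v, hn⟩, by simp⟩
  | @cons a t p h ih =>
    rcases List.mem_cons.1 hv with rfl | hv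
    · exact ⟨a :: p, ⟨.cons a h, hn⟩, by simp⟩
    · obtain ⟨q, hq, hqp⟩ := ih (by simpa using hv) (List.nodup_cons.1 hn).2
      exact ⟨q, hq, fun b hb => List.mem_cons_of_mem _ (hqp hb)⟩

/-- The nodes from which `t` is reachable within a set of arcs form a set entered by none of
these arcs. -/
theorem tail_reach_of_head_reach {t : V} {F : Set A} {a : A} (ha : a ∈ F)
    (h : ∃ p, D.IsDipath (D.head a) t p ∧ ∀ b ∈ p, b ∈ F) :
    ∃ p, D.IsDipath (D.tail a) t p ∧ ∀ b ∈ p, b ∈ F := by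
  obtain ⟨p, hp, hpF⟩ := h
  by_cases hm : D.tail a ∈ D.head a :: p.map D.head
  · obtain ⟨q, hq, hqp⟩ := hp.exists_suffix hm
    exact ⟨q, hq, fun b hb => hpF b (hqp hb)⟩
  · refine ⟨a :: p, ⟨.cons a hp.1, ?_⟩, by simpa [ha] using hpF⟩
    rw [List.map_cons]
    exact List.nodup_cons.2 ⟨hm, hp.2⟩

/-- The hypothesis says, tested against potentials, that `F` is a flow of value `k` from `s` to `t`.
If `s` could not reach `t` in `F`, the indicator of the nodes that can would make the left side
nonnegative and the right side `-k`. -/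
theorem exists_isDipath_of_flow [Fintype V] {F : Finset A} {s t : V} {k : ℤ} (hk : 0 < k)
    (hF : ∀ g : V → ℤ, ∑ a ∈ F, (g (D.tail a) - g (D.head a)) = k * (g s - g t)) :
    ∃ p, D.IsDipath s t p ∧ ∀ a ∈ p, a ∈ F := by
  classical
  by_contra hcon
  set R : V → Prop := fun v => ∃ p, D.IsDipath v t p ∧ ∀ a ∈ p, a ∈ (F : Set A) with hR
  have hs : ¬ R s := hcon
  have ht : R t := ⟨[], ⟨.nil t, by simp⟩, by simp⟩
  have h := hF fun v => if R v then 1 else 0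
  have hnn : 0 ≤ ∑ a ∈ F, (((if R (D.tail a) then 1 else 0) : ℤ) -
      if R (D.head a) then 1 else 0) := by
    refine Finset.sum_nonneg fun a ha => ?_
    have : R (D.head a) → R (D.tail a) := tail_reach_of_head_reach (Finset.mem_coe.2 ha)
    by_cases h1 : R (D.head a)
    · simp [h1, this h1]
    · by_cases h2 : R (D.tail a) <;> simp [h1, h2]
  rw [h] at hnn
  simp only [hs, ht, if_true, if_false] at hnn
  linarith

/-! ### In-degrees, entering cuts and arc reversal. -/

variable [DecidableEq V]

theorem inDegree_eq_card [Fintype A] (D : DirMultigraph V A) (v : V) :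
    D.inDegree v = (Finset.univ.filter fun a => D.head a = v).card := by
  rw [inDegree, ← Set.ncard_coe_finset]
  simp

theorem sum_mul_inDegree [Fintype A] [Fintype V] (D : DirMultigraph V A) (g : V → ℤ) :
    ∑ v, g v * D.inDegree v = ∑ a, g (D.head a) := by
  simp_rw [inDegree_eq_card, Finset.card_filter]
  push_cast
  simp_rw [Finset.mul_sum]
  rw [Finset.sum_comm]
  simp

theorem sum_inDegree [Fintype A] [Fintype V] (D : DirMultigraph V A) :
    ∑ v, D.inDegree v = Fintype.card A := by
  have := D.sum_mul_inDegree fun _ => 1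
  simp only [one_mul, Finset.sum_const, Finset.card_univ, nsmul_eq_mul, mul_one] at this
  exact_mod_cast this

theorem sum_finset_inDegree [Fintype A] [Fintype V] (D : DirMultigraph V A) (X : Finset V) :
    ∑ v ∈ X, (D.inDegree v : ℤ) = ∑ a, if D.head a ∈ X then 1 else 0 := by
  rw [← D.sum_mul_inDegree fun v => if v ∈ X then 1 else 0]
  simp

/-- The number of arcs entering `X`. -/
def cutIn [Fintype A] (D : DirMultigraph V A) (X : Finset V) : ℕ :=
  (Finset.univ.filter fun a => D.head a ∈ X ∧ D.tail a ∉ X).card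

/-- `s` is linked to `t` if at least two arcs enter each set separating `t` from `s`. -/
def Linked [Fintype A] (D : DirMultigraph V A) (s t : V) : Prop :=
  ∀ X : Finset V, t ∈ X → s ∉ X → 2 ≤ D.cutIn X

variable [Fintype A]

theorem cast_cutIn (D : DirMultigraph V A) (X : Finset V) :
    (D.cutIn X : ℤ) = ∑ a, if D.head a ∈ X ∧ D.tail a ∉ X then 1 else 0 := by
  rw [cutIn, Finset.card_filter]
  push_cast
  rfl

theorem cutIn_inter_add_cutIn_union_le (D : DirMultigraph V A) (X Y : Finset V) :
    D.cutIn (X ∩ Y) + D.cutIn (X ∪ Y) ≤ D.cutIn X + D.cutIn Y := by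
  zify
  simp_rw [cast_cutIn]
  rw [← Finset.sum_add_distrib, ← Finset.sum_add_distrib]
  refine Finset.sum_le_sum fun a _ => ?_
  simp only [Finset.mem_inter, Finset.mem_union]
  by_cases h1 : D.head a ∈ X <;> by_cases h2 : D.head a ∈ Y <;> by_cases h3 : D.tail a ∈ X <;>
    by_cases h4 : D.tail a ∈ Y <;> simp [h1, h2, h3, h4]

theorem cutIn_pos_iff {X : Finset V} :
    0 < D.cutIn X ↔ ∃ a, D.head a ∈ X ∧ D.tail a ∉ X := by
  simp [cutIn, Finset.card_pos, Finset.Nonempty]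

theorem IsStrong.cutIn_pos (hD : D.IsStrong) {X : Finset V} {s t : V} (ht : t ∈ X)
    (hs : s ∉ X) : 0 < D.cutIn X := by
  obtain ⟨p, hp⟩ := hD s t
  obtain ⟨a, -, ha⟩ := hp.1.exists_mem_entering X hs ht
  exact cutIn_pos_iff.2 ⟨a, ha⟩

theorem exists_isDipath_of_cutIn_pos [Fintype V] {s t : V}
    (h : ∀ X : Finset V, t ∈ X → s ∉ X → 0 < D.cutIn X) : ∃ p, D.IsDipath s t p := by
  classical
  by_contra hcon
  have ht : ∃ p, D.IsDipath t t p := ⟨[], .nil t, by simp⟩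
  obtain ⟨a, ha, ha'⟩ := cutIn_pos_iff.1
    (h (Finset.univ.filter fun v => ∃ p, D.IsDipath v t p) (by simpa) (by simpa using hcon))
  simp only [Finset.mem_filter, Finset.mem_univ, true_and] at ha ha'
  obtain ⟨p, hp⟩ := ha
  obtain ⟨q, hq, -⟩ :=
    tail_reach_of_head_reach (F := Set.univ) (Set.mem_univ a) ⟨p, hp, by simp⟩
  exact ha' ⟨q, hq⟩

theorem isStrong_of_cutIn_pos [Fintype V]
    (h : ∀ (X : Finset V) (s t : V), t ∈ X → s ∉ X → 0 < D.cutIn X) : D.IsStrong :=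
  fun s t => exists_isDipath_of_cutIn_pos fun X ht hs => h X s t ht hs

theorem HasTwoArcDisjointDipaths.linked {s t : V} (h : D.HasTwoArcDisjointDipaths s t) :
    D.Linked s t := by
  intro X ht hs
  obtain ⟨p, q, hp, hq, hpq⟩ := h
  obtain ⟨a, hap, ha⟩ := hp.1.exists_mem_entering X hs ht
  obtain ⟨b, hbq, hb⟩ := hq.1.exists_mem_entering X hs ht
  refine Finset.one_lt_card.2 ⟨a, by simpa using ha, b, by simpa using hb, ?_⟩
  rintro rfl
  exact hpq hap hbq

/-- `D'` arises from `D` by reversing some arcs. -/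
def IsReorientation (D D' : DirMultigraph V A) : Prop :=
  ∀ a, (D'.tail a = D.tail a ∧ D'.head a = D.head a) ∨
    (D'.tail a = D.head a ∧ D'.head a = D.tail a)

omit [DecidableEq V] [Fintype A] in
theorem IsReorientation.trans {D'' : DirMultigraph V A} (h : D.IsReorientation D')
    (h' : D'.IsReorientation D'') : D.IsReorientation D'' := by
  intro a
  rcases h a with ⟨h1, h2⟩ | ⟨h1, h2⟩ <;> rcases h' a with ⟨h3, h4⟩ | ⟨h3, h4⟩ <;>
    simp [h1, h2, h3, h4]

theorem IsReorientation.sum_reversed (h : D.IsReorientation D') (g : V → ℤ) :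
    ∑ a with D'.head a ≠ D.head a, (g (D.tail a) - g (D.head a)) =
      ∑ a, g (D'.head a) - ∑ a, g (D.head a) := by
  rw [Finset.sum_filter, ← Finset.sum_sub_distrib]
  refine Finset.sum_congr rfl fun a _ => ?_
  rcases h a with ⟨h1, h2⟩ | ⟨h1, h2⟩
  · simp [h2]
  · rw [h2]
    split_ifs with h3
    · rfl
    -- A reversed arc that keeps its head is a loop and contributes 0.
    · rw [not_not] at h3
      simp [h3]

/-- An arc with head in `X` either enters `X` or lies inside it, and the number of inside arcs does
not depend on the orientation. -/
theorem IsReorientation.cutIn_sub_cutIn (h : D.IsReorientation D') (X : Finset V) :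
    (D'.cutIn X : ℤ) - D.cutIn X =
      (∑ a, if D'.head a ∈ X then 1 else 0) - ∑ a, if D.head a ∈ X then 1 else 0 := by
  rw [cast_cutIn, cast_cutIn, ← Finset.sum_sub_distrib, ← Finset.sum_sub_distrib]
  refine Finset.sum_congr rfl fun a _ => ?_
  rcases h a with ⟨h1, h2⟩ | ⟨h1, h2⟩
  · simp [h1, h2]
  · rw [h1, h2]
    by_cases h3 : D.head a ∈ X <;> by_cases h4 : D.tail a ∈ X <;> simp [h3, h4]

theorem IsReorientation.sum_inDegree_le_iff [Fintype V] (h : D.IsReorientation D')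
    (X : Finset V) :
    ∑ v ∈ X, (D.inDegree v : ℤ) ≤ ∑ v ∈ X, (D'.inDegree v : ℤ) ↔ D.cutIn X ≤ D'.cutIn X := by
  have := h.cutIn_sub_cutIn X
  rw [sum_finset_inDegree, sum_finset_inDegree]
  omega

/-- The directed multigraph obtained by reversing the arcs in `F`. -/
def reverse [DecidableEq A] (D : DirMultigraph V A) (F : Finset A) : DirMultigraph V A where
  tail a := if a ∈ F then D.head a else D.tail a
  head a := if a ∈ F then D.tail a else D.head a

variable [DecidableEq A]

omit [DecidableEq V] [Fintype A] in
theorem isReorientation_reverse (D : DirMultigraph V A) (F : Finset A) :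
    D.IsReorientation (D.reverse F) := by
  intro a
  by_cases h : a ∈ F <;> simp [reverse, h]

omit [DecidableEq V] in
theorem IsDipath.sum_head_reverse {s t : V} {p : List A} (hp : D.IsDipath s t p) (g : V → ℤ) :
    ∑ a, g ((D.reverse p.toFinset).head a) = ∑ a, g (D.head a) + (g s - g t) := by
  rw [← hp.sum_eq g, ← sub_eq_iff_eq_add', ← Finset.sum_sub_distrib,
    ← Finset.sum_subset (Finset.subset_univ p.toFinset)]
  · exact Finset.sum_congr rfl fun a ha => by simp only [reverse, if_pos ha]
  · intro a _ ha
    simp only [reverse, if_neg ha, sub_self]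

theorem IsDipath.inDegree_reverse [Fintype V] {s t : V} {p : List A} (hp : D.IsDipath s t p)
    (v : V) : ((D.reverse p.toFinset).inDegree v : ℤ) =
      D.inDegree v + (if v = s then 1 else 0) - (if v = t then 1 else 0) := by
  have h := hp.sum_head_reverse fun w => if v = w then 1 else 0
  rw [← sum_mul_inDegree _ fun w => if v = w then (1 : ℤ) else 0,
    ← sum_mul_inDegree _ fun w => if v = w then (1 : ℤ) else 0] at h
  simp only [ite_mul, one_mul, zero_mul, Finset.sum_ite_eq, Finset.mem_univ, if_true] at h
  rw [h]
  ring

theorem IsDipath.cutIn_reverse {s t : V} {p : List A} (hp : D.IsDipath s t p) (X : Finset V) :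
    ((D.reverse p.toFinset).cutIn X : ℤ) =
      D.cutIn X + ((if s ∈ X then 1 else 0) - (if t ∈ X then 1 else 0)) := by
  have h := (D.isReorientation_reverse p.toFinset).cutIn_sub_cutIn X
  rw [hp.sum_head_reverse fun w => if w ∈ X then 1 else 0] at h
  linarith

/-- Only cuts of sets containing `t` but not `s` shrink, by 1, and linkedness gives them at least 2.
-/
theorem IsDipath.isStrong_reverse [Fintype V] {s t : V} {p : List A} (hp : D.IsDipath s t p)
    (hD : D.IsStrong) (hst : D.Linked s t) : (D.reverse p.toFinset).IsStrong := by
  refine isStrong_of_cutIn_pos fun X u v hv hu => ?_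
  have h := hp.cutIn_reverse X
  have h1 := hD.cutIn_pos hv hu
  have h2 := hst X
  by_cases hs : s ∈ X <;> by_cases ht : t ∈ X <;> simp [hs, ht] at h h2 <;> omega

omit [DecidableEq A] in
/-- Menger's theorem for two arc-disjoint dipaths. -/
theorem Linked.hasTwoArcDisjointDipaths [Fintype V] {s t : V} (h : D.Linked s t) :
    D.HasTwoArcDisjointDipaths s t := by
  classical
  obtain ⟨p₁, hp₁⟩ := exists_isDipath_of_cutIn_pos
    fun X ht hs => two_pos.trans_le (h X ht hs)
  -- An augmenting dipath in the residual digraph: each relevant cut lost only one arc.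
  obtain ⟨p₂, hp₂⟩ : ∃ p, (D.reverse p₁.toFinset).IsDipath s t p := by
    refine exists_isDipath_of_cutIn_pos fun X ht hs => ?_
    have h1 := hp₁.cutIn_reverse X
    have h2 := h X ht hs
    simp [hs, ht] at h1
    omega
  set D₂ := (D.reverse p₁.toFinset).reverse p₂.toFinset
  have hre : D.IsReorientation D₂ :=
    (D.isReorientation_reverse _).trans (isReorientation_reverse _ _)
  -- Arcs used by `p₁` and back by `p₂` cancel. The remaining arcs form a flow of value 2, from
  -- which two dipaths are peeled off.
  set F := Finset.univ.filter fun a => D₂.head a ≠ D.head a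
  have hF (g : V → ℤ) : ∑ a ∈ F, (g (D.tail a) - g (D.head a)) = 2 * (g s - g t) := by
    rw [hre.sum_reversed, hp₂.sum_head_reverse, hp₁.sum_head_reverse]
    ring
  obtain ⟨p, hp, hpF⟩ := exists_isDipath_of_flow two_pos hF
  have hF' (g : V → ℤ) :
      ∑ a ∈ F \ p.toFinset, (g (D.tail a) - g (D.head a)) = 1 * (g s - g t) := by
    have h1 := hF g
    rw [← Finset.sum_sdiff (fun a ha => hpF a (List.mem_toFinset.1 ha)), hp.sum_eq g] at h1
    linarith
  obtain ⟨q, hq, hqF⟩ := exists_isDipath_of_flow one_pos hF'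
  refine ⟨p, q, hp, hq, fun a hap haq => ?_⟩
  simpa [hap] using hqF a haq

/-! ### Tight sets and optimality -/

section Tight

variable [Fintype V]

omit [DecidableEq A]

omit [Fintype V] in
/-- Crossing sets entered by just one arc can be uncrossed. -/
theorem IsStrong.cutIn_union_eq_one (hD : D.IsStrong) {X Y : Finset V} {u v : V}
    (hX : D.cutIn X = 1) (hY : D.cutIn Y = 1) (hu : u ∈ X ∩ Y) (hv : v ∉ X ∪ Y) :
    D.cutIn (X ∪ Y) = 1 ∧ D.cutIn (X ∩ Y) = 1 := by
  have h1 := D.cutIn_inter_add_cutIn_union_le X Y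
  have h2 := hD.cutIn_pos (Finset.mem_union_left Y (Finset.mem_inter.1 hu).1) hv
  have h3 := hD.cutIn_pos hu (fun h => hv (Finset.mem_union_left Y (Finset.mem_inter.1 h).1))
  omega

/-- Each node outside `X` is excluded by a set that includes `X` and is entered by just one
arc. -/
def CoTight (D : DirMultigraph V A) (X : Finset V) : Prop :=
  X.Nonempty ∧ ∀ u ∉ X, ∃ T, X ⊆ T ∧ u ∉ T ∧ D.cutIn T = 1

omit [Fintype V] in
theorem CoTight.union (hD : D.IsStrong) {X Y : Finset V} (hX : D.CoTight X)
    (hY : D.CoTight Y) (h : (X ∩ Y).Nonempty) : D.CoTight (X ∪ Y) := by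
  refine ⟨h.mono (Finset.inter_subset_union), fun u hu => ?_⟩
  rw [Finset.mem_union, not_or] at hu
  obtain ⟨S, hXS, huS, hS⟩ := hX.2 u hu.1
  obtain ⟨T, hYT, huT, hT⟩ := hY.2 u hu.2
  obtain ⟨w, hw⟩ := h
  have huST : u ∉ S ∪ T := by simp [huS, huT]
  exact ⟨S ∪ T, Finset.union_subset_union hXS hYT, huST,
    (hD.cutIn_union_eq_one hS hT (Finset.inter_subset_inter hXS hYT hw) huST).1⟩

/-- A set entered by one arc in `D` has minimum total in-degree, since every strong reorientation
has an arc entering it; its complement then has maximum total. Such complements avoiding `X` cover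
`Xᶜ` and are closed under unions of intersecting pairs, so `Xᶜ` has maximum total and `X` minimum.
-/
theorem CoTight.sum_inDegree_le (hD : D.IsStrong) (hD' : D'.IsStrong)
    (h : D.IsReorientation D') {X : Finset V} (hX : D.CoTight X) :
    0 ≤ ∑ v ∈ X, ((D'.inDegree v : ℤ) - D.inDegree v) := by
  have htot : ∑ v, ((D'.inDegree v : ℤ) - D.inDegree v) = 0 := by
    rw [Finset.sum_sub_distrib, sub_eq_zero]
    exact_mod_cast D'.sum_inDegree.trans D.sum_inDegree.symm
  have hcompl (C : Finset V) : ∑ v ∈ C, ((D'.inDegree v : ℤ) - D.inDegree v) +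
      ∑ v ∈ Cᶜ, ((D'.inDegree v : ℤ) - D.inDegree v) = 0 := by
    rw [Finset.sum_add_sum_compl, htot]
  obtain ⟨⟨x, hx⟩, hX⟩ := hX
  have key : 0 ≤ ∑ v ∈ Xᶜ, -((D'.inDegree v : ℤ) - D.inDegree v) := by
    refine Finset.sum_nonneg_of_intersecting_cover
      (fun C => C.Nonempty ∧ Disjoint C X ∧ D.cutIn Cᶜ = 1) ?_ _ ?_ _ ?_
    · rintro B C ⟨hB, hBX, hB1⟩ ⟨-, hCX, hC1⟩ ⟨v, hv⟩
      refine ⟨hB.mono Finset.subset_union_left, Finset.disjoint_union_left.2 ⟨hBX, hCX⟩, ?_⟩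
      rw [Finset.compl_union]
      refine (hD.cutIn_union_eq_one (u := x) (v := v) hB1 hC1 ?_ ?_).2
      · simp [Finset.disjoint_right.1 hBX hx, Finset.disjoint_right.1 hCX hx]
      · simpa using hv
    · rintro C ⟨⟨v, hv⟩, hCX, hC⟩
      have h1 := hcompl C
      have hpos := hD'.cutIn_pos (X := Cᶜ) (s := v) (t := x)
        (by simp [Finset.disjoint_right.1 hCX hx]) (by simpa using hv)
      have h2 := (h.sum_inDegree_le_iff Cᶜ).2 (by omega)
      rw [Finset.sum_sub_distrib (s := Cᶜ)] at h1
      rw [Finset.sum_neg_distrib]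
      linarith
    · intro u hu
      obtain ⟨T, hXT, huT, hT⟩ := hX u (by simpa using hu)
      refine ⟨Tᶜ, ⟨⟨u, by simpa using huT⟩, ?_, by simpa using hT⟩, by simpa using huT, ?_⟩
      · exact Finset.disjoint_left.2 fun v hv hvX => (Finset.mem_compl.1 hv) (hXT hvX)
      · exact Finset.compl_subset_compl.2 hXT
  rw [Finset.sum_neg_distrib] at key
  linarith [hcompl X]

/-- A set closed under passing to linked predecessors has minimum total in-degree in `D`, over
all strong reorientations. -/
theorem IsReorientation.sum_inDegree_le_of_closed (h : D.IsReorientation D') (hD : D.IsStrong)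
    (hD' : D'.IsStrong) {H : Finset V} (hH : ∀ s t, t ∈ H → D.Linked s t → s ∈ H) :
    0 ≤ ∑ v ∈ H, ((D'.inDegree v : ℤ) - D.inDegree v) := by
  classical
  refine Finset.sum_nonneg_of_intersecting_cover D.CoTight
    (fun X Y hX hY => hX.union hD hY) _ (fun X hX => hX.sum_inDegree_le hD hD' h) H fun t ht => ?_
  have htt : D.Linked t t := fun X h1 h2 => absurd h1 h2
  -- The nodes linked to `t` form a co-tight set: a node `u` not linked to `t` is excluded by a set
  -- `T` entered by one arc, and `T` must contain every node linked to `t`.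
  refine ⟨Finset.univ.filter fun s => D.Linked s t, ⟨⟨t, by simpa using htt⟩, fun u hu => ?_⟩,
    by simpa using htt, fun s hs => hH s t ht (by simpa using hs)⟩
  obtain ⟨T, htT, huT, hT⟩ : ∃ T : Finset V, t ∈ T ∧ u ∉ T ∧ D.cutIn T < 2 := by
    have hu' : ¬ D.Linked u t := by simpa using hu
    unfold Linked at hu'
    push Not at hu'
    exact hu'
  refine ⟨T, fun s hs => ?_, huT, ?_⟩
  · by_contra hsT
    exact absurd ((Finset.mem_filter.1 hs).2 T htT hsT) hT.not_ge
  · have := hD.cutIn_pos htT huT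
    omega

theorem IsReorientation.sum_inDegree_sub_le (h : D.IsReorientation D') (hD : D.IsStrong)
    (hD' : D'.IsStrong) (hloc : ∀ s t, D.Linked s t → D.inDegree t ≤ D.inDegree s + 1) (k : ℕ) :
    ∑ v, (D.inDegree v - k) ≤ ∑ v, (D'.inDegree v - k) := by
  classical
  have htrans {r s t : V} (h1 : D.Linked r s) (h2 : D.Linked s t) : D.Linked r t := by
    intro X ht hr
    by_cases hs : s ∈ X
    · exact h1 X hs hr
    · exact h2 X ht hs
  set H := Finset.univ.filter fun s => ∃ t, k < D.inDegree t ∧ D.Linked s t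
  have hle := h.sum_inDegree_le_of_closed hD hD' (H := H) (by
    intro s t ht hst
    obtain ⟨w, hw, htw⟩ := (Finset.mem_filter.1 ht).2
    exact Finset.mem_filter.2 ⟨Finset.mem_univ s, w, hw, htrans hst htw⟩)
  have h1 : ∑ v, ((D.inDegree v - k : ℕ) : ℤ) = ∑ v ∈ H, ((D.inDegree v : ℤ) - k) := by
    rw [← Finset.sum_subset (Finset.subset_univ H)]
    · refine Finset.sum_congr rfl fun v hv => ?_
      obtain ⟨t, ht, hvt⟩ := (Finset.mem_filter.1 hv).2
      -- Here `k + 1 ≤ D.inDegree t ≤ D.inDegree v + 1`, so the natural subtraction is exact.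
      have := hloc v t hvt
      omega
    · intro v _ hv
      have : ¬ k < D.inDegree v := fun hk => hv (Finset.mem_filter.2
        ⟨Finset.mem_univ v, v, hk, fun X h1 h2 => absurd h1 h2⟩)
      omega
  have h2 : ∑ v ∈ H, ((D'.inDegree v : ℤ) - k) ≤ ∑ v, ((D'.inDegree v - k : ℕ) : ℤ) :=
    (Finset.sum_le_sum fun v _ => by omega).trans
      (Finset.sum_le_sum_of_subset_of_nonneg (Finset.subset_univ H) fun v _ _ => by positivity)
  zify
  rw [h1]
  refine le_trans ?_ h2
  rw [← sub_nonneg, ← Finset.sum_sub_distrib]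
  simpa using hle

end Tight

end DirMultigraph

/-! ### Strong orientations -/

namespace Graph.Orientation

variable {α β : Type*} {G : Graph α β}

theorem isReorientation (D D' : G.Orientation) :
    D.toDirMultigraph.IsReorientation D'.toDirMultigraph := by
  intro e
  rcases (D'.isLink e).eq_and_eq_or_eq_and_eq (D.isLink e) with ⟨h1, h2⟩ | ⟨h1, h2⟩
  · exact .inl ⟨Subtype.ext h1, Subtype.ext h2⟩
  · exact .inr ⟨Subtype.ext h1, Subtype.ext h2⟩

/-- The orientation obtained by reversing the arcs in `F`. -/
def reverse [DecidableEq E(G)] (D : G.Orientation) (F : Finset E(G)) : G.Orientation where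
  toDirMultigraph := D.toDirMultigraph.reverse F
  isLink e := by
    by_cases h : e ∈ F
    · simpa [DirMultigraph.reverse, h] using (D.isLink e).symm
    · simpa [DirMultigraph.reverse, h] using D.isLink e

variable [Fintype V(G)] [Finite E(G)]

theorem sum_inDegree_eq (D D' : G.Orientation) :
    ∑ v, D.inDegree v = ∑ v, D'.inDegree v := by
  classical
  have := Fintype.ofFinite E(G)
  exact D.sum_inDegree.trans D'.sum_inDegree.symm

theorem sum_inDegree_sub_le {D : G.Orientation} (hD : D.IsStrong)
    (hloc : ¬ ∃ s t : V(G), D.inDegree t ≥ D.inDegree s + 2 ∧ D.HasTwoArcDisjointDipaths s t)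
    {y : V(G) → ℕ} (hy : y ∈ G.strongInDegrees) (k : ℕ) :
    ∑ v, (D.inDegree v - k) ≤ ∑ v, (y v - k) := by
  classical
  have := Fintype.ofFinite E(G)
  obtain ⟨D', hD', rfl⟩ := hy
  refine (D.isReorientation D').sum_inDegree_sub_le hD hD' (fun s t hst => ?_) k
  by_contra! hlt
  exact hloc ⟨s, t, hlt, hst.hasTwoArcDisjointDipaths⟩

theorem exists_transfer {D : G.Orientation} (hD : D.IsStrong)
    (h : ∃ s t : V(G), D.inDegree t ≥ D.inDegree s + 2 ∧ D.HasTwoArcDisjointDipaths s t) :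
    ∃ D' : G.Orientation, D'.IsStrong ∧
      (∀ k, ∑ v, (D'.inDegree v - k) ≤ ∑ v, (D.inDegree v - k)) ∧
      ∃ k, ∑ v, (D'.inDegree v - k) < ∑ v, (D.inDegree v - k) := by
  classical
  have := Fintype.ofFinite E(G)
  obtain ⟨s, t, hst, h2⟩ := h
  obtain ⟨p, q, hp, -⟩ := id h2
  exact ⟨D.reverse p.toFinset, hp.isStrong_reverse hD h2.linked,
    sum_sub_lt_of_transfer hst hp.inDegree_reverse⟩

theorem isDecMinStrong_iff {D : G.Orientation} (hD : D.IsStrong) :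
    D.IsDecMinStrong ↔
      ¬ ∃ s t : V(G), D.inDegree t ≥ D.inDegree s + 2 ∧ D.HasTwoArcDisjointDipaths s t := by
  refine ⟨fun h hex => ?_, fun h => ⟨hD, ⟨D, hD, rfl⟩, fun y hy =>
    decLE_of_sum_sub_le (sum_inDegree_sub_le hD h hy)⟩⟩
  obtain ⟨D', hD', hle, k, hk⟩ := exists_transfer hD hex
  -- Minimality of `D` would make some truncated sum smaller for `D` than for `D'`, or all of them
  -- equal; the transfer excludes both.
  rcases (h.2.2 _ ⟨D', hD', rfl⟩).exists_sum_sub_lt_or_forall_eq with ⟨j, hj⟩ | heq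
  · exact absurd (hle j) hj.not_ge
  · exact hk.ne' (heq k)

theorem isIncMaxStrong_iff {D : G.Orientation} (hD : D.IsStrong) :
    D.IsIncMaxStrong ↔
      ¬ ∃ s t : V(G), D.inDegree t ≥ D.inDegree s + 2 ∧ D.HasTwoArcDisjointDipaths s t := by
  refine ⟨fun h hex => ?_, fun h => ⟨hD, ⟨D, hD, rfl⟩, ?_⟩⟩
  · obtain ⟨D', hD', hle, k, hk⟩ := exists_transfer hD hex
    rcases (h.2.2 _ ⟨D', hD', rfl⟩).exists_sum_sub_lt_or_forall_eq (D.sum_inDegree_eq D')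
      with ⟨j, hj⟩ | heq
    · exact absurd (hle j) hj.not_ge
    · exact hk.ne' (heq k)
  · intro y hy
    refine incGE_of_sum_sub_le ?_ (sum_inDegree_sub_le hD h hy)
    obtain ⟨D', -, rfl⟩ := hy
    exact D.sum_inDegree_eq D'

end Graph.Orientation

theorem theorem9p1 {α β : Type*} (G : Graph α β) [Fintype V(G)] [Finite E(G)] [G.Loopless]
    (D : G.Orientation) (hD : D.IsStrong) :
    (D.IsDecMinStrong ↔
      ¬ ∃ s t : V(G), D.inDegree t ≥ D.inDegree s + 2 ∧ D.HasTwoArcDisjointDipaths s t) ∧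
    (D.IsDecMinStrong ↔ D.IsIncMaxStrong) :=
  ⟨Graph.Orientation.isDecMinStrong_iff hD,
    (Graph.Orientation.isDecMinStrong_iff hD).trans
      (Graph.Orientation.isIncMaxStrong_iff hD).symm⟩
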